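/- **Setting.** Let $V$ be a finite set of vertices (players) and let $VP$, $EP$ be sets of unary (vertex) and binary (edge) predicate symbols. Annotations are built from constants in $[0,1]$, annotation variables ranging over $[0,1]$, and annotation function symbols, each denoting a fixed function $[0,1]^n\to[0,1]$. A GAP is a finite set of annotated rules $A_0:\mu_0\leftarrow A_1:\mu_1,\dots,A_n:\mu_n$, where the $A_i$ are atoms whose terms are vertices or variables ranging over $V$ and the $\mu_i$ are annotations. An interpretation maps the ground atoms to $[0,1]$. It satisfies a rule if, for every instance of the rule (all variables replaced by values) with $I(A_i)\ge\mu_i$ for $i\ge1$, also $I(A_0)\ge\mu_0$. Every GAP $G$ has a (pointwise) minimum model $\mathcal{MM}(G)$. A Choice GAP $\Pi$ of size $m$ is a GAP together with one vertex choice rule $b_1(X),\dots,b_m(X)\hookleftarrow a_1(X),\dots,a_m(X)$, with distinct vertex predicates $b_i$ and distinct vertex predicates $a_i$; the choice rule is satisfied by $I$ at $v\in V$ if for some $i$ we have $I(b_i(v))=I(a_i(v))$ and $I(b_j(v))=0$ for all $j\ne i$. A model $I$ of $\Pi$ (of all rules, and of the choice rule at every vertex) is *coherent* if it is the minimum model of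 the GAP consisting of the annotated rules of $\Pi$ and the rules $b_i(v):X\leftarrow a_i(v):X$ ($X$ an annotation variable) for all $v,i$ with $I(a_i(v))=I(b_i(v))>0$. A coherent model is a *strong equilibrium* if $\sum_i I(b_i(v))=\max_i I(a_i(v))$ for every $v\in V$. The *dependency graph* of $\Pi$ has the (vertex and edge) predicate symbols as nodes, an edge from each predicate in the body of a rule to the predicate in its head, and the edges $(a_i,b_i)$. $\Pi$ is a $VIC_m$ program if no $b_i$ occurs in the head of an annotated rule and, for $i\neq j$, there is no path (possibly of length $0$) from $b_j$ to $a_i$. A *state* is a map $S:V\to\{1,\dots,m\}$; $\Pi_S$ is the GAP consisting of the annotated rules of $\Pi$ and the rules $b_{S(v)}(v):X\leftarrow a_{S(v)}(v):X$, $v\in V$; the utility is $u(S,v,i)=\mathcal{MM}(\Pi_S)(a_i(v))$; and $S$ *represents a strong equilibrium* if $u(S,v,S(v))\ge u(S,v,i)$ for all $v,i$. For $m=2$, algorithm *findSE* starts with $S\equiv1$; while $S$ does not represent a strong equilibrium, it sets $S(v)=2$ for all $v$ with $u(S,v,1)<u(S,v,2)$ (utilities of the state at the start of the round); finally it returns $\mathcal{MM}(\Pi_S)$.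 Let $T_G(I)(A)$ be the supremum of the head annotations of the instances of rules of $G$ with head atom $A$ whose bodies hold in $I$. Running times count elementary steps: writing a symbol of a ground rule, an assignment, a comparison of two numbers in $[0,1]$, the evaluation of one symbol of an annotation, and a test of a loop guard. The size $|\Pi|$ is $|V|$ plus the number of symbols of the rules. **Theorem.** 1. Every $VIC_2$ program has a strong equilibrium. 2. There is a polynomial $p$ such that, for every $VIC_2$ program $\Pi$ and every procedure that computes $\mathcal{MM}(\Pi_S)$ from $S$ in at most $M$ steps, findSE, using this procedure, halts after at most $p(|V|+M)$ steps. It returns $\mathcal{MM}(\Pi_S)$ for a state $S$ that represents a strong equilibrium, and $\mathcal{MM}(\Pi_S)$ is a strong equilibrium. 3. For every $k$ there is a polynomial $p$ such that the following holds for every $VIC_2$ program $\Pi$ whose rules have at most $k$ vertex variables each, whose annotation functions are monotone, and in which annotations in rule bodies are variables or constants. If $\mathcal{MM}(\Pi_S)$ is reached, for every state $S$, by $T$ iterations of $T_{\Pi_S}$ from the zero interpretation, then findSE, with minimum models computed by grounding $\Pi_S$ and iterating $T_{\Pi_S}$ until nothing changes, halts after at most $p(|\Pi|+T)$ steps and returns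 a strong equilibrium as in 2. 4. For every $k$ there is a polynomial $p$ such that, for every $VIC_2$ program $\Pi$ whose rules have at most $k$ vertex variables each and all of whose annotations are variables or constants, the algorithm in 3 halts after at most $p(|\Pi|)$ steps and returns a strong equilibrium as in 2. -/

import Mathlib

namespace ChoiceGAP

open Classical

/-! ### The annotation language -/

/-- Annotation function symbols, with arities; each denotes a fixed function
`[0,1]^n → [0,1]`. -/
structure AnnSig where
  Sym : Type
  arity : Sym → ℕ
  interp : (f : Sym) → (Fin (arity f) → unitInterval) → unitInterval

/-- Annotations over `n` annotation variables. -/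
inductive Annot (σ : AnnSig) (n : ℕ) : Type
  | const (c : unitInterval) : Annot σ n
  | var (x : Fin n) : Annot σ n
  | app (f : σ.Sym) (args : Fin (σ.arity f) → Annot σ n) : Annot σ n

namespace Annot

variable {σ : AnnSig} {n : ℕ}

/-- Value of an annotation when the annotation variables have the values `θ`. -/
noncomputable def eval (θ : Fin n → unitInterval) : Annot σ n → unitInterval
  | const c => c
  | var x => θ x
  | app f args => σ.interp f (fun i => eval θ (args i))

/-- Number of symbols. -/
def size : Annot σ n → ℕ
  | const _ => 1
  | var _ => 1
  | app _ args => 1 + ∑ i, size (args i)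

/-- The annotation is a variable or a constant. -/
def IsSimple : Annot σ n → Prop
  | const _ => True
  | var _ => True
  | app _ _ => False

end Annot

/-! ### Atoms, rules, programs -/

/-- Atoms over terms from `T`: a vertex predicate applied to one term, or an edge predicate
applied to two terms. -/
inductive Atom (VP EP T : Type) : Type
  | vertex (p : VP) (t : T) : Atom VP EP T
  | edge (e : EP) (s t : T) : Atom VP EP T

namespace Atom

variable {VP EP T T' : Type}

/-- The predicate symbol of an atom. -/
def pred : Atom VP EP T → VP ⊕ EP
  | vertex p _ => Sum.inl p
  | edge e _ _ => Sum.inr e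

/-- Replace the terms in an atom. -/
def map (g : T → T') : Atom VP EP T → Atom VP EP T'
  | vertex p t => vertex p (g t)
  | edge e s t => edge e (g s) (g t)

end Atom

/-- An annotated rule `head : ann ← body`, whose atoms have terms in `T` and whose annotation
variables are `0, …, numAnn - 1`. -/
structure AnnRule (σ : AnnSig) (VP EP T : Type) where
  numAnn : ℕ
  head : Atom VP EP T
  ann : Annot σ numAnn
  body : List (Atom VP EP T × Annot σ numAnn)

/-- Rules all of whose atoms are ground (over the vertex set `V`). -/
abbrev GRule (σ : AnnSig) (V VP EP : Type) := AnnRule σ VP EP V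

/-- Ground atoms. -/
abbrev GAtom (V VP EP : Type) := Atom VP EP V

/-- Rules as they are written in a program: a term is a vertex (a constant) or one of the
rule's logical variables `0, …, numVars - 1`. -/
structure Rule (σ : AnnSig) (V VP EP : Type) where
  numVars : ℕ
  rule : AnnRule σ VP EP (V ⊕ Fin numVars)

/-- Number of symbols of a rule (each atom counts as one symbol). -/
def AnnRule.size {σ : AnnSig} {VP EP T : Type} (r : AnnRule σ VP EP T) : ℕ :=
  1 + r.numAnn + r.ann.size + (r.body.map (fun q => 1 + q.2.size)).sum

/-- Number of symbols of a rule. -/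
def Rule.size {σ : AnnSig} {V VP EP : Type} (r : Rule σ V VP EP) : ℕ :=
  r.numVars + r.rule.size

/-- The instance of a rule in which the logical variables are replaced by vertices. -/
def Rule.inst {σ : AnnSig} {V VP EP : Type} (r : Rule σ V VP EP) (s : Fin r.numVars → V) :
    GRule σ V VP EP where
  numAnn := r.rule.numAnn
  head := r.rule.head.map (Sum.elim id s)
  ann := r.rule.ann
  body := r.rule.body.map (fun q => (q.1.map (Sum.elim id s), q.2))

/-- A Choice GAP: finitely many annotated rules and one vertex choice rule
`b_1(X), …, b_m(X) ↩ a_1(X), …, a_m(X)`. Action `i` of the players is `i - 1 : Fin m`. -/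
structure CGAP (σ : AnnSig) (V VP EP : Type) (m : ℕ) where
  rules : List (Rule σ V VP EP)
  a : Fin m → VP
  b : Fin m → VP
  a_injective : Function.Injective a
  b_injective : Function.Injective b

/-! ### Interpretations, minimum models, the fixpoint operator -/

/-- Interpretations, ordered pointwise. -/
abbrev Interp (V VP EP : Type) := GAtom V VP EP → unitInterval

section Semantics

variable {σ : AnnSig} {V VP EP : Type} {m : ℕ}

/-- The body of `r` holds in `I` for the values `θ` of the annotation variables. -/
def GRule.BodyHolds (r : GRule σ V VP EP) (I : Interp V VP EP)
    (θ : Fin r.numAnn → unitInterval) : Prop :=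
  ∀ q ∈ r.body, q.2.eval θ ≤ I q.1

/-- `I` satisfies `r`, i.e. all instances of `r` under values of the annotation variables. -/
def GRule.Sat (r : GRule σ V VP EP) (I : Interp V VP EP) : Prop :=
  ∀ θ : Fin r.numAnn → unitInterval, r.BodyHolds I θ → r.ann.eval θ ≤ I r.head

/-- The models of a GAP (given by its rules with ground atoms). -/
def models (G : Set (GRule σ V VP EP)) : Set (Interp V VP EP) :=
  {I | ∀ r ∈ G, r.Sat I}

/-- The minimum model of a GAP. -/
noncomputable def minModel (G : Set (GRule σ V VP EP)) : Interp V VP EP :=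
  sInf (models G)

/-- `minModel G` really is the minimum of the models. -/
theorem minModel_isLeast (G : Set (GRule σ V VP EP)) : IsLeast (models G) (minModel G) := by
  refine ⟨?_, fun J hJ => sInf_le hJ⟩
  intro r hr θ hb
  have h : ∀ J ∈ models G, r.ann.eval θ ≤ J r.head := by
    intro J hJ
    refine hJ r hr θ (fun q hq => (hb q hq).trans ?_)
    exact (sInf_le hJ : minModel G ≤ J) q.1
  change r.ann.eval θ ≤ (sInf (models G)) r.head
  rw [sInf_apply]
  exact le_iInf (fun J => h J.1 J.2)

/-- The operator `T_G`: the value of an atom is the supremum of the head annotations of the rule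
instances with that head whose body holds (the supremum of the empty set is `0`). -/
noncomputable def tp (G : Set (GRule σ V VP EP)) (I : Interp V VP EP) : Interp V VP EP :=
  fun A => sSup {x | ∃ r ∈ G, r.head = A ∧ ∃ θ, r.BodyHolds I θ ∧ x = r.ann.eval θ}

/-! ### Coherent models and strong equilibria -/

namespace CGAP

variable (P : CGAP σ V VP EP m)

/-- The ground instances of the annotated rules. -/
def groundRules : Set (GRule σ V VP EP) :=
  {g | ∃ r ∈ P.rules, ∃ s, g = r.inst s}

/-- The ground rule `b_i(v) : X ← a_i(v) : X`, with `X` an annotation variable. -/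
def choiceRule (v : V) (i : Fin m) : GRule σ V VP EP where
  numAnn := 1
  head := Atom.vertex (P.b i) v
  ann := Annot.var 0
  body := [(Atom.vertex (P.a i) v, Annot.var 0)]

/-- `I` satisfies the instance of the vertex choice rule at the vertex `v`. -/
def SatChoice (I : Interp V VP EP) (v : V) : Prop :=
  ∃ i, I (Atom.vertex (P.b i) v) = I (Atom.vertex (P.a i) v) ∧
    ∀ j, j ≠ i → I (Atom.vertex (P.b j) v) = 0

/-- `I` is a model of the Choice GAP. -/
def IsModel (I : Interp V VP EP) : Prop :=
  I ∈ models P.groundRules ∧ ∀ v, P.SatChoice I v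

/-- The coherence transform of the program with respect to `I`. -/
def coh (I : Interp V VP EP) : Set (GRule σ V VP EP) :=
  P.groundRules ∪ {g | ∃ v i, 0 < I (Atom.vertex (P.a i) v) ∧
    I (Atom.vertex (P.a i) v) = I (Atom.vertex (P.b i) v) ∧ g = P.choiceRule v i}

/-- Coherent models. -/
def IsCoherent (I : Interp V VP EP) : Prop :=
  P.IsModel I ∧ IsLeast (models (P.coh I)) I

/-- Strong equilibria: coherent models in which, for every vertex `v`, the sum of the `b_i(v)` is
the maximum of the `a_i(v)`. -/
def IsStrongEquilibrium (I : Interp V VP EP) : Prop :=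
  P.IsCoherent I ∧ ∀ v : V,
    IsGreatest (Set.range (fun i : Fin m => (I (Atom.vertex (P.a i) v) : ℝ)))
      (∑ i : Fin m, (I (Atom.vertex (P.b i) v) : ℝ))

/-! ### The game -/

/-- The GAP induced by a state `S`, which assigns an action to every vertex (player). -/
def induced (S : V → Fin m) : Set (GRule σ V VP EP) :=
  P.groundRules ∪ {g | ∃ v, g = P.choiceRule v (S v)}

/-- The utility of action `i` for the player `v`, read off an interpretation. -/
def value (I : Interp V VP EP) (v : V) (i : Fin m) : unitInterval :=
  I (Atom.vertex (P.a i) v)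

/-- The utility of action `i` for the player `v` in the state `S`. -/
noncomputable def utility (S : V → Fin m) (v : V) (i : Fin m) : unitInterval :=
  P.value (minModel (P.induced S)) v i

/-- The state `S` represents a strong equilibrium. -/
def Represents (S : V → Fin m) : Prop :=
  ∀ v i, P.utility S v i ≤ P.utility S v (S v)

/-! ### VIC programs -/

/-- The edges `(p, q)` of the dependency graph on all (vertex and edge) predicate symbols. -/
def Depends (p q : VP ⊕ EP) : Prop :=
  (∃ r ∈ P.rules, (∃ l ∈ r.rule.body, l.1.pred = p) ∧ r.rule.head.pred = q) ∨
  (∃ i, p = Sum.inl (P.a i) ∧ q = Sum.inl (P.b i))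

/-- Vertex independent choice programs. A path may have length `0`. -/
def IsVIC : Prop :=
  (∀ r ∈ P.rules, ∀ i, r.rule.head.pred ≠ Sum.inl (P.b i)) ∧
  ∀ i j, i ≠ j → ¬ Relation.ReflTransGen P.Depends (Sum.inl (P.b j)) (Sum.inl (P.a i))

/-! ### Data that the running time depends on -/

/-- Size of the program: the number of vertices, plus the number of symbols of the rules. -/
def size [Fintype V] : ℕ :=
  Fintype.card V + (P.rules.map Rule.size).sum

/-- The annotation functions are monotone, and annotations in rule bodies are variables or
constants. -/
def IsSimple : Prop :=
  (∀ f, Monotone (σ.interp f)) ∧ ∀ r ∈ P.rules, ∀ q ∈ r.rule.body, q.2.IsSimple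

/-- All annotations in the rules are variables or constants. -/
def IsElementary : Prop :=
  ∀ r ∈ P.rules, r.rule.ann.IsSimple ∧ ∀ q ∈ r.rule.body, q.2.IsSimple

/-- For every state, `T` iterations of the operator of the induced GAP, from the
interpretation that is constantly `0`, reach its minimum model. -/
def ReachedWithin (T : ℕ) : Prop :=
  ∀ S : V → Fin m, (tp (P.induced S))^[T] (fun _ => 0) = minModel (P.induced S)

end CGAP

end Semantics

/-! ### Programs with a step counter

`Comp α` is the type of possibly non-terminating computations that return a value in `α`. The state
is the number of elementary steps so far. -/

abbrev Comp (α : Type) := StateT ℕ Part α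

namespace Comp

/-- Charge `n` elementary steps. -/
def tick (n : ℕ) : Comp Unit := modify (fun t => t + n)

/-- `while cond do body`, one step being charged for each evaluation of the guard, besides the
steps of the guard and of the body. -/
noncomputable def whileLoop {α : Type} (cond : α → Comp Bool) (body : α → Comp α) (x : α) :
    Comp α := fun t =>
  PFun.fix (fun p : α × ℕ => do
    let (c, t₁) ← (do tick 1; cond p.1 : Comp Bool).run p.2
    if c then
      let q ← (body p.1).run t₁
      pure (Sum.inr q)
    else
      pure (Sum.inl (p.1, t₁))) (x, t)

/-- `Comp.Returns c x t`: the computation `c` halts after exactly `t` steps and returns `x`. -/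
def Returns {α : Type} (c : Comp α) (x : α) (t : ℕ) : Prop :=
  c.run 0 = Part.some (x, t)

end Comp

/-! ### Algorithm findSE -/

section Algorithm

variable {σ : AnnSig} {V VP EP : Type} [Fintype V]

/-- The vertices, in some order. -/
noncomputable def vertices (V : Type) [Fintype V] : List V := Finset.univ.toList

namespace CGAP

/-- `findSE`, given a procedure `mm` that returns the minimum model of the GAP induced by a state.
Action `1` is `0 : Fin 2`, action `2` is `1 : Fin 2`. Utilities are read off minimum models; one
step is charged for every comparison and for every assignment. -/
noncomputable def findSE (P : CGAP σ V VP EP 2) (mm : (V → Fin 2) → Comp (Interp V VP EP)) :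
    Comp (Interp V VP EP) := do
  -- let S assign action 1 to every player
  Comp.tick (Fintype.card V)
  let S ← Comp.whileLoop
    -- while S does not represent a strong equilibrium
    (fun S => do
      let I ← mm S
      (vertices V).foldlM (fun (bad : Bool) v => do
        Comp.tick 2
        pure (bad || decide (∃ i, P.value I v (S v) < P.value I v i))) false)
    -- for all players with a strictly higher utility for action 2: set their action to 2
    (fun S => do
      let I ← mm S
      (vertices V).foldlM (fun S' v => do
        Comp.tick 1
        if P.value I v 0 < P.value I v 1 then
          Comp.tick 1
          pure (Function.update S' v 1)
        else pure S') S)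
    (fun _ => 0)
  mm S

/-- The procedure `mm` returns the minimum model of the GAP induced by any given state, in at most
`M` steps. -/
def ComputesMM (P : CGAP σ V VP EP 2) (mm : (V → Fin 2) → Comp (Interp V VP EP)) (M : ℕ) : Prop :=
  ∀ (S : V → Fin 2) (t : ℕ), ∃ c ≤ M, (mm S).run t = Part.some (minModel (P.induced S), t + c)

/-- Write out the ground rules of the GAP induced by `S`, in as many steps as symbols. -/
noncomputable def ground (P : CGAP σ V VP EP 2) (S : V → Fin 2) :
    Comp (List (GRule σ V VP EP)) := do
  let G ← P.rules.foldlM (fun G (r : Rule σ V VP EP) =>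
    (Finset.univ : Finset (Fin r.numVars → V)).toList.foldlM (fun G s => do
      Comp.tick r.size
      pure (r.inst s :: G)) G) []
  (vertices V).foldlM (fun G v => do
    Comp.tick (P.choiceRule v (S v)).size
    pure (P.choiceRule v (S v) :: G)) G

end CGAP

/-- Evaluate a ground rule at `I`: give each annotation variable the least value of the body atoms
that it annotates (`1` if there are none), compare the constants in the body with the values of
their atoms, and return the value of the head annotation, or `0` if a comparison fails. Each step is
an initialisation, a comparison, or the evaluation of one symbol of the head annotation.
Only meant for bodies that are annotated by variables and constants. -/
noncomputable def evalRule {σ : AnnSig} {V VP EP : Type} (r : GRule σ V VP EP)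
    (I : Interp V VP EP) : Comp unitInterval := do
  Comp.tick r.numAnn
  let (θ, ok) ← r.body.foldlM (fun (acc : (Fin r.numAnn → unitInterval) × Bool) q => do
    Comp.tick 1
    match q.2 with
    | Annot.var x => pure (Function.update acc.1 x (min (acc.1 x) (I q.1)), acc.2)
    | Annot.const c => pure (acc.1, acc.2 && decide (c ≤ I q.1))
    | Annot.app _ _ => pure acc) ((fun _ => 1), true)
  Comp.tick r.ann.size
  pure (if ok then r.ann.eval θ else 0)

/-- One application of the fixpoint operator: start from `0` everywhere, go through the rules and
raise the value of the head to the value of the rule. -/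
noncomputable def applyRules {σ : AnnSig} {V VP EP : Type} (G : List (GRule σ V VP EP))
    (I : Interp V VP EP) : Comp (Interp V VP EP) :=
  G.foldlM (fun J r => do
    let x ← evalRule r I
    Comp.tick 1
    pure (Function.update J r.head (max (J r.head) x))) (fun _ => 0)

/-- The minimum model of the GAP induced by `S`, by iterating the fixpoint operator from `0` until
no rule head changes its value any more. -/
noncomputable def CGAP.iterMM {σ : AnnSig} {V VP EP : Type} [Fintype V]
    (P : CGAP σ V VP EP 2) (S : V → Fin 2) : Comp (Interp V VP EP) := do
  let G ← P.ground S
  Comp.whileLoop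
    (fun I => do
      let J ← applyRules G I
      G.foldlM (fun (changed : Bool) r => do
        Comp.tick 1
        pure (changed || decide (J r.head ≠ I r.head))) false)
    (fun I => applyRules G I)
    (fun _ => 0)

end Algorithm

end ChoiceGAP

namespace ChoiceGAP

open Classical

/-! ### The fixpoint operator and minimum models -/

section Semantics

variable {σ : AnnSig} {V VP EP : Type} {m : ℕ}

/-! Existence rests on a monotonicity property. By the VIC condition, no choice rule for an action
other than `i` feeds a predicate from which `a_i` can be reached. On the atoms with such predicates
the minimum models of two induced GAPs can therefore be compared rule by rule (`minModel_le_on`),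
and the utility of `i` can only grow when more players choose `i` (`utility_mono`). `findSE` moves
players from action `0` to action `1` only, so utilities of `0` fall and those of `1` rise: nobody
who has switched regrets it. A state that is not yet an equilibrium must then contain a player of
action `0` who gains by switching, so there are at most `|V|` rounds.

A state yields a coherent model because the atoms `b_i(v)` are supported by choice rules alone. In
the minimum model of the induced GAP, `b_{S v}(v)` equals `a_{S v}(v)` and the other `b_j(v)`
vanish, so the coherence transform loses only choice rules of value `0` (`minModel_isCoherent`).

For the fixpoint procedure, body annotations that are variables or constants give each rule a
greatest admissible valuation, or none. A monotone head annotation attains its supremum there, so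
the executable step computes the operator (`applyValue_eq_tp`). Without annotation functions no
values arise beyond `0`, `1` and the constants of the program, and a rank argument bounds the number
of iterations (`iterate_stationary`). -/

theorem tp_apply_le_iff {G : Set (GRule σ V VP EP)} {I : Interp V VP EP} {A : GAtom V VP EP}
    {y : unitInterval} :
    tp G I A ≤ y ↔ ∀ r ∈ G, r.head = A → ∀ θ, r.BodyHolds I θ → r.ann.eval θ ≤ y := by
  unfold tp
  rw [sSup_le_iff]
  constructor
  · intro h r hr hA θ hθ
    exact h _ ⟨r, hr, hA, θ, hθ, rfl⟩
  · rintro h x ⟨r, hr, hA, θ, hθ, rfl⟩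
    exact h r hr hA θ hθ

theorem GRule.BodyHolds.mono {r : GRule σ V VP EP} {I J : Interp V VP EP}
    {θ : Fin r.numAnn → unitInterval} (h : r.BodyHolds I θ) (hIJ : I ≤ J) : r.BodyHolds J θ :=
  fun q hq => (h q hq).trans (hIJ q.1)

/-- The annotation functions need not be monotone here: the interpretation enters only through the
bodies, and a larger one merely admits more instances. -/
theorem tp_monotone (G : Set (GRule σ V VP EP)) : Monotone (tp G) := by
  intro I J hIJ A
  exact tp_apply_le_iff.2 fun r hr hA θ hθ =>
    tp_apply_le_iff.1 le_rfl r hr hA θ (hθ.mono hIJ)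

theorem mem_models_iff_tp_le {G : Set (GRule σ V VP EP)} {I : Interp V VP EP} :
    I ∈ models G ↔ tp G I ≤ I := by
  constructor
  · intro h A
    refine tp_apply_le_iff.2 ?_
    rintro r hr rfl θ hθ
    exact h r hr θ hθ
  · intro h r hr θ hθ
    exact tp_apply_le_iff.1 (h r.head) r hr rfl θ hθ

/-- Knaster–Tarski: by monotonicity the operator maps the minimum model to a model, which minimality
puts above it. -/
theorem tp_minModel (G : Set (GRule σ V VP EP)) : tp G (minModel G) = minModel G := by
  have h := mem_models_iff_tp_le.1 (minModel_isLeast G).1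
  exact le_antisymm h ((minModel_isLeast G).2 (mem_models_iff_tp_le.2 (tp_monotone G h)))

/-- Support principle: a value in the minimum model must be justified by rules with that head whose
bodies hold there. -/
theorem minModel_apply_le {G : Set (GRule σ V VP EP)} {A : GAtom V VP EP} {y : unitInterval}
    (h : ∀ r ∈ G, r.head = A → ∀ θ, r.BodyHolds (minModel G) θ → r.ann.eval θ ≤ y) :
    minModel G A ≤ y := by
  rw [← tp_minModel]
  exact tp_apply_le_iff.2 h

theorem iterate_tp_le_minModel (G : Set (GRule σ V VP EP)) (n : ℕ) :
    (tp G)^[n] (fun _ => 0) ≤ minModel G := by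
  induction n with
  | zero => exact fun A => unitInterval.nonneg'
  | succ n ih =>
    rw [Function.iterate_succ_apply', ← tp_minModel G]
    exact tp_monotone G ih

theorem iterate_tp_eq_minModel {G : Set (GRule σ V VP EP)} {n : ℕ}
    (h : tp G ((tp G)^[n] (fun _ => 0)) = (tp G)^[n] (fun _ => 0)) :
    (tp G)^[n] (fun _ => 0) = minModel G :=
  le_antisymm (iterate_tp_le_minModel G n)
    ((minModel_isLeast G).2 (mem_models_iff_tp_le.2 h.le))

/-- If the rules of `G` with heads in `R` belong to `G'` and have bodies in `R`, then the minimum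
model of `G` is below that of `G'` on `R`. -/
theorem minModel_le_on {G G' : Set (GRule σ V VP EP)} {R : Set (GAtom V VP EP)}
    (h : ∀ r ∈ G, r.head ∈ R → r ∈ G' ∧ ∀ q ∈ r.body, q.1 ∈ R) {A : GAtom V VP EP}
    (hA : A ∈ R) : minModel G A ≤ minModel G' A := by
  -- The value `1` outside `R` satisfies every rule with head outside `R` for free; the remaining
  -- rules see only atoms of `R`.
  let J : Interp V VP EP := fun B => if B ∈ R then minModel G' B else 1
  have hJ : J ∈ models G := by
    intro r hr θ hb
    by_cases hR : r.head ∈ R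
    · obtain ⟨hr', hbody⟩ := h r hr hR
      simp only [J, if_pos hR]
      refine (minModel_isLeast G').1 r hr' θ fun q hq => ?_
      simpa [J, hbody q hq] using hb q hq
    · simp only [J, if_neg hR]
      exact unitInterval.le_one'
  simpa [J, hA] using (minModel_isLeast G).2 hJ A

/-! ### Strong equilibria from states -/

namespace CGAP

variable (P : CGAP σ V VP EP m)

theorem pred_map {T T' : Type} (g : T → T') (A : Atom VP EP T) : (A.map g).pred = A.pred := by
  cases A <;> rfl

variable {P}

theorem minModel_mem_models_groundRules (S : V → Fin m) :
    minModel (P.induced S) ∈ models P.groundRules :=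
  fun r hr => (minModel_isLeast (P.induced S)).1 r (Or.inl hr)

theorem head_ne_of_mem_groundRules (hP : P.IsVIC) {r : GRule σ V VP EP} (hr : r ∈ P.groundRules)
    (v : V) (i : Fin m) : r.head ≠ Atom.vertex (P.b i) v := by
  obtain ⟨r, hr, s, rfl⟩ := hr
  intro h
  apply hP.1 r hr i
  rw [← pred_map (Sum.elim id s)]
  exact congrArg Atom.pred h

theorem minModel_b (hP : P.IsVIC) (S : V → Fin m) (v : V) :
    minModel (P.induced S) (Atom.vertex (P.b (S v)) v) =
      minModel (P.induced S) (Atom.vertex (P.a (S v)) v) := by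
  apply le_antisymm
  · refine minModel_apply_le ?_
    rintro r (hr | ⟨w, rfl⟩) hA θ hθ
    · exact absurd hA (head_ne_of_mem_groundRules hP hr _ _)
    · obtain rfl : w = v := by
        simp only [choiceRule, Atom.vertex.injEq] at hA
        exact hA.2
      exact hθ (Atom.vertex (P.a (S w)) w, Annot.var (0 : Fin 1)) (List.mem_singleton.2 rfl)
  · have := (minModel_isLeast (P.induced S)).1 (P.choiceRule v (S v)) (Or.inr ⟨v, rfl⟩)
      (fun _ => minModel (P.induced S) (Atom.vertex (P.a (S v)) v))
    refine this fun q hq => ?_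
    obtain rfl : q = (Atom.vertex (P.a (S v)) v, Annot.var (0 : Fin 1)) :=
      List.mem_singleton.1 hq
    exact le_rfl

theorem minModel_b_of_ne (hP : P.IsVIC) (S : V → Fin m) {v : V} {j : Fin m} (hj : j ≠ S v) :
    minModel (P.induced S) (Atom.vertex (P.b j) v) = 0 := by
  refine le_antisymm (minModel_apply_le ?_) unitInterval.nonneg'
  rintro r (hr | ⟨w, rfl⟩) hA θ hθ
  · exact absurd hA (head_ne_of_mem_groundRules hP hr _ _)
  · simp only [choiceRule, Atom.vertex.injEq] at hA
    obtain ⟨h1, rfl⟩ := hA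
    exact absurd (P.b_injective h1).symm hj

theorem minModel_isCoherent (hP : P.IsVIC) (S : V → Fin m) :
    P.IsCoherent (minModel (P.induced S)) := by
  refine ⟨⟨minModel_mem_models_groundRules S, fun v => ⟨S v, minModel_b hP S v, fun j hj =>
    minModel_b_of_ne hP S hj⟩⟩, ?_, ?_⟩
  · rintro r (hr | ⟨v, i, hpos, heq, rfl⟩)
    · exact minModel_mem_models_groundRules S r hr
    · by_cases hi : i = S v
      · subst hi
        exact (minModel_isLeast (P.induced S)).1 _ (Or.inr ⟨v, rfl⟩)
      · rw [heq, minModel_b_of_ne hP S hi] at hpos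
        exact absurd hpos (lt_irrefl _)
  · intro J hJ
    -- A model `J` of the transform need not satisfy the dropped choice rules, but its meet with the
    -- minimum model does.
    refine le_trans ((minModel_isLeast (P.induced S)).2 (?_ : J ⊓ minModel (P.induced S) ∈ _))
      inf_le_left
    intro r hr θ hθ
    have hI := (minModel_isLeast (P.induced S)).1 r hr θ (hθ.mono inf_le_right)
    refine le_inf ?_ hI
    rcases hr with hr | ⟨v, rfl⟩
    · exact hJ r (Or.inl hr) θ (hθ.mono inf_le_left)
    · by_cases h0 : 0 < minModel (P.induced S) (Atom.vertex (P.a (S v)) v)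
      · exact hJ _ (Or.inr ⟨v, S v, h0, (minModel_b hP S v).symm, rfl⟩) θ (hθ.mono inf_le_left)
      -- A dropped choice rule of `S` has value `0` at `a_{S v}(v)`, hence at `b_{S v}(v)` in the
      -- minimum model, so `J` has nothing to satisfy.
      · refine hI.trans ?_
        change minModel (P.induced S) (Atom.vertex (P.b (S v)) v) ≤ _
        rw [minModel_b hP S v]
        exact (not_lt.1 h0).trans unitInterval.nonneg'

theorem Represents.isStrongEquilibrium (hP : P.IsVIC) {S : V → Fin m} (hS : P.Represents S) :
    P.IsStrongEquilibrium (minModel (P.induced S)) := by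
  refine ⟨minModel_isCoherent hP S, fun v => ?_⟩
  have hsum : ∑ i : Fin m, (minModel (P.induced S) (Atom.vertex (P.b i) v) : ℝ) =
      minModel (P.induced S) (Atom.vertex (P.a (S v)) v) := by
    rw [Finset.sum_eq_single (S v), minModel_b hP S v]
    · intro j _ hj
      rw [minModel_b_of_ne hP S hj]
      rfl
    · simp
  rw [hsum]
  refine ⟨⟨S v, rfl⟩, ?_⟩
  rintro _ ⟨i, rfl⟩
  exact hS v i

/-- The utility of an action grows with the set of players that choose it. -/
theorem utility_mono (hP : P.IsVIC) {S S' : V → Fin m} {i : Fin m}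
    (h : ∀ v, S v = i → S' v = i) (v : V) : P.utility S v i ≤ P.utility S' v i := by
  -- `R` is closed under passing from heads to bodies, and the VIC condition keeps out the heads of
  -- choice rules for actions other than `i`.
  let R : Set (GAtom V VP EP) :=
    {A | Relation.ReflTransGen P.Depends A.pred (Sum.inl (P.a i))}
  refine minModel_le_on (R := R) ?_ (Relation.ReflTransGen.refl : _)
  rintro r (⟨r, hr, s, rfl⟩ | ⟨w, rfl⟩) hR
  · refine ⟨Or.inl ⟨r, hr, s, rfl⟩, fun q hq => ?_⟩
    obtain ⟨l, hl, rfl⟩ := List.mem_map.1 hq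
    refine Relation.ReflTransGen.head (Or.inl ⟨r, hr, ⟨l, hl, ?_⟩, ?_⟩) hR
    · exact (pred_map _ _).symm
    · exact (pred_map _ _).symm
  · have hw : S w = i := by
      by_contra hne
      exact hP.2 i (S w) (Ne.symm hne) hR
    refine ⟨Or.inr ⟨w, by rw [hw, h w hw]⟩, fun q hq => ?_⟩
    obtain rfl : q = (Atom.vertex (P.a (S w)) w, Annot.var (0 : Fin 1)) :=
      List.mem_singleton.1 hq
    exact Relation.ReflTransGen.head (Or.inr ⟨S w, rfl, rfl⟩) hR

end CGAP

end Semantics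

/-! ### Cost of computations -/

/-- From every counter value, `c` halts with value `x` after at most `B` further steps. -/
def RunsIn {α : Type} (c : Comp α) (x : α) (B : ℕ) : Prop :=
  ∀ t, ∃ n ≤ B, c.run t = Part.some (x, t + n)

namespace RunsIn

variable {α β γ : Type}

theorem mono {c : Comp α} {x : α} {B B' : ℕ} (h : RunsIn c x B) (hB : B ≤ B') :
    RunsIn c x B' := fun t =>
  let ⟨n, hn, h⟩ := h t
  ⟨n, hn.trans hB, h⟩

theorem exists_returns {c : Comp α} {x : α} {B : ℕ} (h : RunsIn c x B) :
    ∃ t ≤ B, Comp.Returns c x t := by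
  obtain ⟨n, hn, h⟩ := h 0
  exact ⟨n, hn, by simpa [Comp.Returns] using h⟩

theorem pure (x : α) : RunsIn (Pure.pure x) x 0 := fun _ => ⟨0, le_rfl, rfl⟩

theorem tick (n : ℕ) : RunsIn (Comp.tick n) () n := fun _ => ⟨n, le_rfl, rfl⟩

theorem bind {c : Comp α} {f : α → Comp β} {x : α} {y : β} {B B' : ℕ} (hc : RunsIn c x B)
    (hf : RunsIn (f x) y B') : RunsIn (c >>= f) y (B + B') := by
  intro t
  obtain ⟨n, hn, h1⟩ := hc t
  obtain ⟨k, hk, h2⟩ := hf (t + n)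
  refine ⟨n + k, Nat.add_le_add hn hk, ?_⟩
  rw [StateT.run_bind, h1]
  refine (Part.bind_some _ _).trans ?_
  rw [← add_assoc]
  exact h2

theorem tick_bind (n : ℕ) {d : Comp α} {x : α} {B : ℕ} (h : RunsIn d x B) :
    RunsIn (do Comp.tick n; d) x (n + B) :=
  (tick n).bind (f := fun _ => d) h

theorem foldlM {f : β → α → Comp β} {g : β → α → β} {B : α → ℕ} :
    ∀ {l : List α}, (∀ b, ∀ a ∈ l, RunsIn (f b a) (g b a) (B a)) → ∀ b,
      RunsIn (l.foldlM f b) (l.foldl g b) (l.map B).sum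
  | [], _, b => pure b
  | a :: l, h, b => by
    rw [List.foldlM_cons, List.foldl_cons, List.map_cons, List.sum_cons]
    exact (h b a (by simp)).bind (foldlM (fun b a ha => h b a (by simp [ha])) (g b a))

theorem whileLoop_stop {cond : α → Comp Bool} (body : α → Comp α) {x : α} {B : ℕ}
    (h : RunsIn (cond x) false B) : RunsIn (Comp.whileLoop cond body x) x (1 + B) := by
  intro t
  have hc : RunsIn (do Comp.tick 1; cond x : Comp Bool) false (1 + B) := tick_bind 1 h
  obtain ⟨c, hcB, hc⟩ := hc t
  refine ⟨c, hcB, Part.eq_some_iff.2 (PFun.fix_stop ?_)⟩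
  refine Part.mem_bind (Part.eq_some_iff.1 hc) ?_
  simp

theorem whileLoop_step {cond : α → Comp Bool} {body : α → Comp α} {x y z : α} {B B' B'' : ℕ}
    (h : RunsIn (cond x) true B) (hb : RunsIn (body x) y B')
    (hy : RunsIn (Comp.whileLoop cond body y) z B'') :
    RunsIn (Comp.whileLoop cond body x) z (1 + B + B' + B'') := by
  intro t
  have hc : RunsIn (do Comp.tick 1; cond x : Comp Bool) true (1 + B) := tick_bind 1 h
  obtain ⟨c, hcB, hc⟩ := hc t
  obtain ⟨c', hcB', hb⟩ := hb (t + c)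
  obtain ⟨c'', hcB'', hy⟩ := hy (t + c + c')
  refine ⟨c + c' + c'', by omega, ?_⟩
  rw [← add_assoc, ← add_assoc, ← hy]
  refine PFun.fix_fwd_eq (Part.mem_bind (Part.eq_some_iff.1 hc) ?_)
  simp only [if_true]
  exact Part.mem_bind (Part.eq_some_iff.1 hb) (Part.mem_some _)

/-- Total cost of a loop: `Q n` is an invariant of the states from which at most `n` more rounds
are made. -/
theorem whileLoop {cond : α → Comp Bool} {body : α → Comp α} {q : α → Bool} {next : α → α}
    {B B' : ℕ} {Q : ℕ → α → Prop} (hcond : ∀ x, RunsIn (cond x) (q x) B)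
    (hbody : ∀ x, RunsIn (body x) (next x) B')
    (hzero : ∀ x, Q 0 x → q x = false)
    (hsucc : ∀ n x, Q (n + 1) x → q x = true → Q n (next x)) :
    ∀ n x, Q n x → ∃ y k, Q k y ∧ q y = false ∧
      RunsIn (Comp.whileLoop cond body x) y ((n + 1) * (1 + B) + n * B') := by
  intro n
  induction n with
  | zero =>
    intro x hx
    refine ⟨x, 0, hx, hzero x hx, ?_⟩
    refine (whileLoop_stop body (hzero x hx ▸ hcond x)).mono ?_
    omega
  | succ n ih =>
    intro x hx
    by_cases hq : q x = true
    · obtain ⟨y, k, hy, hqy, h⟩ := ih (next x) (hsucc n x hx hq)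
      refine ⟨y, k, hy, hqy, (whileLoop_step (hq ▸ hcond x) (hbody x) h).mono (le_of_eq ?_)⟩
      ring
    · have hq' : q x = false := by simpa using hq
      refine ⟨x, n + 1, hx, hq', (whileLoop_stop body (hq' ▸ hcond x)).mono ?_⟩
      nlinarith

end RunsIn

/-! ### Algorithm findSE -/

theorem foldl_or {α : Type} (p : α → Bool) (l : List α) (c : Bool) :
    l.foldl (fun c a => c || p a) c = (c || l.any p) := by
  induction l generalizing c with
  | nil => simp
  | cons a l ih => simp [ih, Bool.or_assoc]

/-- The test does not look at the function being updated, so the successive updates amount to a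
simultaneous one; this is why a round uses only the utilities of its initial state. -/
theorem foldl_update {α β : Type} (p : α → Prop) (y : β) (l : List α) (S : α → β) :
    l.foldl (fun S a => if p a then Function.update S a y else S) S =
      fun a => if a ∈ l ∧ p a then y else S a := by
  induction l generalizing S with
  | nil => simp
  | cons b l ih =>
    rw [List.foldl_cons, ih]
    funext a
    by_cases hb : p b <;> by_cases hl : a ∈ l ∧ p a <;> by_cases hab : a = b
    all_goals simp_all

section FindSE

variable {σ : AnnSig} {V VP EP : Type} [Fintype V] {P : CGAP σ V VP EP 2}

namespace CGAP

/-- One round of `findSE`. -/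
noncomputable def improve (P : CGAP σ V VP EP 2) (S : V → Fin 2) : V → Fin 2 :=
  fun v => if P.utility S v 0 < P.utility S v 1 then 1 else S v

theorem runsIn_guard {mm : (V → Fin 2) → Comp (Interp V VP EP)} {M : ℕ}
    (hmm : P.ComputesMM mm M) (S : V → Fin 2) :
    RunsIn (do
      let I ← mm S
      (vertices V).foldlM (fun (bad : Bool) v => do
        Comp.tick 2
        pure (bad || decide (∃ i, P.value I v (S v) < P.value I v i))) false : Comp Bool)
      (decide ¬ P.Represents S) (M + Fintype.card V * 2) := by
  have h : (decide ¬ P.Represents S) = (vertices V).foldl (fun (bad : Bool) v =>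
      bad || decide (∃ i, P.utility S v (S v) < P.utility S v i)) false := by
    rw [foldl_or, Bool.false_or, Bool.eq_iff_iff]
    simp only [Represents, vertices, decide_eq_true_eq, List.any_eq_true, Finset.mem_toList,
      Finset.mem_univ, true_and, not_forall, not_le]
  rw [h]
  refine RunsIn.bind (hmm S) (RunsIn.mono (RunsIn.foldlM (B := fun _ => 2) (fun c v _ => ?_) false) ?_)
  · exact RunsIn.tick_bind 2 (RunsIn.pure (c || decide _))
  · simp [vertices]

theorem runsIn_round {mm : (V → Fin 2) → Comp (Interp V VP EP)} {M : ℕ}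
    (hmm : P.ComputesMM mm M) (S : V → Fin 2) :
    RunsIn (do
      let I ← mm S
      (vertices V).foldlM (fun S' v => do
        Comp.tick 1
        if P.value I v 0 < P.value I v 1 then
          Comp.tick 1
          pure (Function.update S' v 1)
        else pure S') S : Comp (V → Fin 2))
      (P.improve S) (M + Fintype.card V * 2) := by
  have h : P.improve S = (vertices V).foldl (fun S' v =>
      if P.utility S v 0 < P.utility S v 1 then Function.update S' v 1 else S') S := by
    rw [foldl_update (fun v => P.utility S v 0 < P.utility S v 1)]
    funext v
    simp [improve, vertices]
  rw [h]
  refine RunsIn.bind (hmm S)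
    (RunsIn.mono (RunsIn.foldlM (B := fun _ => 2) (fun S' v _ => ?_) S) ?_)
  -- Of the two steps per player, one pays for the comparison and one for the assignment that may
  -- follow.
  · refine (RunsIn.tick 1).bind (B' := 1) ?_
    change RunsIn (if P.utility S v 0 < P.utility S v 1 then
      (do Comp.tick 1; pure (Function.update S' v 1)) else pure S') _ _
    by_cases hv : P.utility S v 0 < P.utility S v 1
    · rw [if_pos hv, if_pos hv]
      exact RunsIn.tick_bind 1 (RunsIn.pure (Function.update S' v 1))
    · rw [if_neg hv, if_neg hv]
      exact (RunsIn.pure _).mono zero_le_one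
  · simp [vertices]

-- In a round the players of action `0` become fewer and those of action `1` more. By `utility_mono`
-- the utilities of `0` fall and those of `1` rise, so a preference for `1`, old or new, persists.
omit [Fintype V] in
theorem utility_le_of_improve (hP : P.IsVIC) {S : V → Fin 2}
    (hS : ∀ v, S v = 1 → P.utility S v 0 ≤ P.utility S v 1) (v : V)
    (hv : P.improve S v = 1) : P.utility (P.improve S) v 0 ≤ P.utility (P.improve S) v 1 := by
  have h0 : P.utility (P.improve S) v 0 ≤ P.utility S v 0 := by
    refine utility_mono hP (fun w hw => ?_) v
    simp only [improve] at hw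
    split_ifs at hw with h
    · exact absurd hw (by decide)
    · exact hw
  have h1 : P.utility S v 1 ≤ P.utility (P.improve S) v 1 := by
    refine utility_mono hP (fun w hw => ?_) v
    simp [improve, hw]
  refine h0.trans (le_trans ?_ h1)
  simp only [improve] at hv
  split_ifs at hv with h
  · exact h.le
  · exact hS v hv

/-- The invariant of the loop of `findSE`. -/
def LoopInv (P : CGAP σ V VP EP 2) (n : ℕ) (S : V → Fin 2) : Prop :=
  (∀ v, S v = 1 → P.utility S v 0 ≤ P.utility S v 1) ∧ (Finset.univ.filter (S · = 0)).card ≤ n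

/-- The invariant forbids a player of action `1` to prefer `0`, so a failure of equilibrium can only
come from a player of action `0`. -/
theorem LoopInv.exists_improves {n : ℕ} {S : V → Fin 2} (h : P.LoopInv n S)
    (hS : ¬ P.Represents S) : ∃ v, S v = 0 ∧ P.utility S v 0 < P.utility S v 1 := by
  simp only [Represents, not_forall, not_le] at hS
  obtain ⟨v, i, hv⟩ := hS
  have h2 : ∀ j : Fin 2, j = 0 ∨ j = 1 := by decide
  rcases h2 (S v) with hs | hs <;> rcases h2 i with rfl | rfl <;> rw [hs] at hv
  · exact absurd hv (lt_irrefl _)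
  · exact ⟨v, hs, hv⟩
  · exact absurd hv (not_lt.2 (h.1 v hs))
  · exact absurd hv (lt_irrefl _)

theorem LoopInv.represents {S : V → Fin 2} (h : P.LoopInv 0 S) : P.Represents S := by
  by_contra hS
  obtain ⟨v, hv, -⟩ := h.exists_improves hS
  have : 0 < (Finset.univ.filter (S · = 0)).card := Finset.card_pos.2 ⟨v, by simpa using hv⟩
  exact absurd h.2 (by omega)

theorem LoopInv.improve (hP : P.IsVIC) {n : ℕ} {S : V → Fin 2} (h : P.LoopInv (n + 1) S)
    (hS : ¬ P.Represents S) : P.LoopInv n (P.improve S) := by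
  refine ⟨utility_le_of_improve hP h.1, ?_⟩
  obtain ⟨v, hv, hlt⟩ := h.exists_improves hS
  refine Nat.le_of_lt_succ (lt_of_lt_of_le (Finset.card_lt_card ?_) h.2)
  refine Finset.ssubset_iff_of_subset ?_ |>.2 ⟨v, by simp [hv], ?_⟩
  · intro w hw
    simp only [Finset.mem_filter, Finset.mem_univ, true_and] at hw ⊢
    simp only [CGAP.improve] at hw
    split_ifs at hw with hw'
    · exact absurd hw (by decide)
    · exact hw
  · simp only [Finset.mem_filter, Finset.mem_univ, true_and]
    simp [CGAP.improve, if_pos hlt]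

/-- `findSE` makes at most `|V|` rounds. -/
theorem runsIn_findSE (hP : P.IsVIC) {mm : (V → Fin 2) → Comp (Interp V VP EP)} {M : ℕ}
    (hmm : P.ComputesMM mm M) :
    ∃ S, P.Represents S ∧ RunsIn (P.findSE mm) (minModel (P.induced S))
      (7 * (Fintype.card V + M + 1) ^ 2) := by
  obtain ⟨S, k, -, hS, hrun⟩ := RunsIn.whileLoop (Q := P.LoopInv) (runsIn_guard hmm)
    (runsIn_round hmm)
    (fun S h => by simpa using h.represents)
    (fun n S h hS => h.improve hP (by simpa using hS))
    (Fintype.card V) (fun _ => 0)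
    ⟨fun v hv => absurd hv zero_ne_one, Finset.card_le_univ _⟩
  refine ⟨S, by simpa using hS, ?_⟩
  -- With `v = |V|` the total is `4v² + 2vM + 4v + 2M + 1`; the factor `7` is generous.
  refine ((RunsIn.tick _).bind (hrun.bind (hmm S))).mono ?_
  nlinarith [Nat.zero_le (Fintype.card V), Nat.zero_le M, Nat.zero_le (Fintype.card V * M), Nat.zero_le (M * M)]

theorem exists_isStrongEquilibrium (hP : P.IsVIC) : ∃ I, P.IsStrongEquilibrium I := by
  -- Existence needs only the correctness of `findSE`, so minimum models may be supplied at no cost.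
  obtain ⟨S, hS, -⟩ := runsIn_findSE hP (mm := fun S => pure (minModel (P.induced S))) (M := 0)
    (fun S => RunsIn.pure _)
  exact ⟨_, hS.isStrongEquilibrium hP⟩

theorem exists_findSE_returns (hP : P.IsVIC) {mm : (V → Fin 2) → Comp (Interp V VP EP)} {M : ℕ}
    (hmm : P.ComputesMM mm M) :
    ∃ (S : V → Fin 2) (t : ℕ),
      Comp.Returns (P.findSE mm) (minModel (P.induced S)) t ∧ P.Represents S ∧
      P.IsStrongEquilibrium (minModel (P.induced S)) ∧
      t ≤ 7 * (Fintype.card V + M + 1) ^ 2 := by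
  obtain ⟨S, hS, h⟩ := runsIn_findSE hP hmm
  obtain ⟨t, ht, h⟩ := h.exists_returns
  exact ⟨S, t, h, hS, hS.isStrongEquilibrium hP, ht⟩

end CGAP

end FindSE

/-! ### Evaluation of rules -/

section Evaluation

variable {σ : AnnSig} {V VP EP : Type}

/-- Rules with monotone head annotations whose body annotations are variables or constants. -/
def AnnRule.IsTame {T : Type} (r : AnnRule σ VP EP T) : Prop :=
  (Monotone fun θ => r.ann.eval θ) ∧ ∀ q ∈ r.body, q.2.IsSimple

theorem Annot.eval_monotone (hσ : ∀ f, Monotone (σ.interp f)) {n : ℕ} (μ : Annot σ n) :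
    Monotone fun θ => μ.eval θ := by
  intro θ θ' h
  induction μ with
  | const c => exact le_rfl
  | var x => exact h x
  | app f args ih => exact hσ f fun i => ih i

theorem Annot.IsSimple.eval_monotone {n : ℕ} {μ : Annot σ n} (hμ : μ.IsSimple) :
    Monotone fun θ => μ.eval θ := by
  intro θ θ' h
  cases μ with
  | const c => exact le_rfl
  | var x => exact h x
  | app f args => exact hμ.elim

/-- The effect of one body atom on the values of the annotation variables and on the flag that
records whether all comparisons succeeded. -/
noncomputable def bodyStep {n : ℕ} (I : Interp V VP EP)
    (acc : (Fin n → unitInterval) × Bool) (q : GAtom V VP EP × Annot σ n) :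
    (Fin n → unitInterval) × Bool :=
  match q.2 with
  | Annot.var x => (Function.update acc.1 x (min (acc.1 x) (I q.1)), acc.2)
  | Annot.const c => (acc.1, acc.2 && decide (c ≤ I q.1))
  | Annot.app _ _ => acc

/-- The greatest values of the annotation variables for which the body holds, and whether there
are any. -/
noncomputable def GRule.bodyValue (r : GRule σ V VP EP) (I : Interp V VP EP) :
    (Fin r.numAnn → unitInterval) × Bool :=
  r.body.foldl (bodyStep I) (fun _ => 1, true)

/-- The value that `evalRule` returns. -/
noncomputable def GRule.value (r : GRule σ V VP EP) (I : Interp V VP EP) : unitInterval :=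
  if (r.bodyValue I).2 then r.ann.eval (r.bodyValue I).1 else 0

/-- The interpretation that `applyRules` returns. -/
noncomputable def applyValue (G : List (GRule σ V VP EP)) (I : Interp V VP EP) :
    Interp V VP EP :=
  G.foldl (fun J r => Function.update J r.head (max (J r.head) (r.value I))) (fun _ => 0)

theorem runsIn_evalRule (r : GRule σ V VP EP) (I : Interp V VP EP) :
    RunsIn (evalRule r I) (r.value I) (r.numAnn + (r.body.length + r.ann.size)) := by
  refine RunsIn.tick_bind _ (RunsIn.bind (x := r.bodyValue I) ?_ ?_)
  · refine (RunsIn.foldlM (B := fun _ => 1) (g := bodyStep I) ?_ _).mono (by simp)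
    rintro acc ⟨A, c | x | ⟨f, args⟩⟩ -
    · exact RunsIn.tick_bind 1 (RunsIn.pure _)
    · exact RunsIn.tick_bind 1 (RunsIn.pure _)
    · exact RunsIn.tick_bind 1 (RunsIn.pure _)
  · exact RunsIn.tick_bind _ (RunsIn.pure _)

theorem length_le_sum_map {α : Type} (f : α → ℕ) (l : List α) :
    l.length ≤ (l.map fun q => 1 + f q).sum := by
  induction l with
  | nil => simp
  | cons a l ih => simp only [List.length_cons, List.map_cons, List.sum_cons]; omega

theorem runsIn_applyRules (G : List (GRule σ V VP EP)) (I : Interp V VP EP) :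
    RunsIn (applyRules G I) (applyValue G I) (G.map AnnRule.size).sum := by
  refine RunsIn.foldlM (fun J r _ => ?_) _
  refine ((runsIn_evalRule r I).bind (B' := 1) ?_).mono ?_
  · exact RunsIn.tick_bind 1 (RunsIn.pure _)
  · have := length_le_sum_map (fun q : Atom VP EP V × Annot σ r.numAnn => q.2.size) r.body
    unfold AnnRule.size
    omega

/-- Each body atom imposes an upper bound on one variable or a condition free of variables, so the
admissible valuations are empty or a principal down-set. An arbitrary accumulator makes the
induction work. -/
theorem foldl_bodyStep_iff {n : ℕ} {I : Interp V VP EP} {θ : Fin n → unitInterval}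
    (body : List (GAtom V VP EP × Annot σ n)) (hbody : ∀ q ∈ body, q.2.IsSimple)
    (acc : (Fin n → unitInterval) × Bool) :
    (θ ≤ (body.foldl (bodyStep I) acc).1 ∧ (body.foldl (bodyStep I) acc).2 = true) ↔
      (θ ≤ acc.1 ∧ acc.2 = true) ∧ ∀ q ∈ body, q.2.eval θ ≤ I q.1 := by
  induction body generalizing acc with
  | nil => simp
  | cons q body ih =>
    rw [List.foldl_cons, ih (fun q hq => hbody q (List.mem_cons_of_mem _ hq)),
      List.forall_mem_cons, ← and_assoc]
    refine and_congr_left fun _ => ?_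
    have hq := hbody q List.mem_cons_self
    obtain ⟨A, c | x | ⟨f, args⟩⟩ := q
    · simp [bodyStep, Annot.eval, and_assoc]
    · simp only [bodyStep, Annot.eval]
      constructor
      · rintro ⟨h, h2⟩
        have hx := h x
        rw [Function.update_self] at hx
        refine ⟨⟨fun y => (h y).trans ?_, h2⟩, hx.trans (min_le_right _ _)⟩
        by_cases hy : y = x
        · subst hy
          rw [Function.update_self]
          exact min_le_left _ _
        · rw [Function.update_of_ne hy]
      · rintro ⟨⟨h, h2⟩, hx⟩
        refine ⟨fun y => ?_, h2⟩
        by_cases hy : y = x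
        · subst hy
          rw [Function.update_self]
          exact le_min (h y) hx
        · rw [Function.update_of_ne hy]
          exact h y
    · exact hq.elim

theorem bodyHolds_iff {r : GRule σ V VP EP} (hr : r.IsTame) {I : Interp V VP EP}
    {θ : Fin r.numAnn → unitInterval} :
    r.BodyHolds I θ ↔ θ ≤ (r.bodyValue I).1 ∧ (r.bodyValue I).2 = true := by
  refine Iff.trans ?_ (foldl_bodyStep_iff r.body hr.2 (fun _ => 1, true)).symm
  have : θ ≤ fun _ => 1 := fun _ => unitInterval.le_one'
  simp [GRule.BodyHolds, this]

/-- Monotonicity of the head annotation makes the greatest admissible valuation attain the supremum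
over all of them. -/
theorem value_le_iff {r : GRule σ V VP EP} (hr : r.IsTame) {I : Interp V VP EP}
    {y : unitInterval} : r.value I ≤ y ↔ ∀ θ, r.BodyHolds I θ → r.ann.eval θ ≤ y := by
  simp only [bodyHolds_iff hr, GRule.value]
  split_ifs with h
  · exact ⟨fun hy θ hθ => (hr.1 hθ.1).trans hy, fun hy => hy _ ⟨le_rfl, h⟩⟩
  · exact ⟨fun _ θ hθ => absurd hθ.2 h, fun _ => unitInterval.nonneg'⟩

theorem foldl_update_max_le_iff {α ι β : Type} [LinearOrder β] (k : α → ι) (f : α → β)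
    (l : List α) (J : ι → β) (A : ι) (y : β) :
    l.foldl (fun J r => Function.update J (k r) (max (J (k r)) (f r))) J A ≤ y ↔
      J A ≤ y ∧ ∀ r ∈ l, k r = A → f r ≤ y := by
  induction l generalizing J with
  | nil => simp
  | cons r l ih =>
    rw [List.foldl_cons, ih, List.forall_mem_cons, ← and_assoc]
    refine and_congr_left fun _ => ?_
    by_cases h : k r = A
    · subst h
      simp
    · simp [h, Function.update_of_ne (Ne.symm h)]

theorem applyValue_eq_tp {G : List (GRule σ V VP EP)} (hG : ∀ r ∈ G, r.IsTame)
    (I : Interp V VP EP) : applyValue G I = tp {r | r ∈ G} I := by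
  funext A
  refine eq_of_forall_ge_iff fun y => ?_
  rw [tp_apply_le_iff, applyValue, foldl_update_max_le_iff]
  simp only [unitInterval.nonneg', true_and, Set.mem_ofPred_eq]
  exact forall₃_congr fun r hr _ => value_le_iff (hG r hr)

/-- Needed because the loop guard compares interpretations at rule heads only. -/
theorem applyValue_eq_zero {G : List (GRule σ V VP EP)} {I : Interp V VP EP}
    {A : GAtom V VP EP} (h : ∀ r ∈ G, r.head ≠ A) : applyValue G I A = 0 := by
  refine le_antisymm ?_ unitInterval.nonneg'
  exact (foldl_update_max_le_iff _ _ _ _ _ _).2 ⟨le_rfl, fun r hr hA => absurd hA (h r hr)⟩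

theorem iterate_applyValue_eq_zero {G : List (GRule σ V VP EP)} {A : GAtom V VP EP}
    (h : ∀ r ∈ G, r.head ≠ A) (n : ℕ) : (applyValue G)^[n] (fun _ => 0) A = 0 := by
  cases n with
  | zero => rfl
  | succ n => rw [Function.iterate_succ_apply', applyValue_eq_zero h]

/-! ### Constants -/

/-- The constants that are used as annotations, at top level, in a rule. -/
def Annot.consts {n : ℕ} : Annot σ n → List unitInterval
  | const c => [c]
  | var _ => []
  | app _ _ => []

def AnnRule.consts {T : Type} (r : AnnRule σ VP EP T) : List unitInterval :=
  r.ann.consts ++ r.body.flatMap fun q => q.2.consts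

theorem Annot.length_consts_le {n : ℕ} (μ : Annot σ n) : μ.consts.length ≤ μ.size := by
  cases μ <;> simp [Annot.consts, Annot.size]

theorem AnnRule.length_consts_le {T : Type} (r : AnnRule σ VP EP T) :
    r.consts.length ≤ r.size := by
  have h : (r.body.flatMap fun q => q.2.consts).length ≤
      (r.body.map fun q => 1 + q.2.size).sum := by
    rw [List.length_flatMap]
    exact List.sum_le_sum fun q _ => (q.2.length_consts_le).trans (Nat.le_add_left _ _)
  have := r.ann.length_consts_le
  rw [AnnRule.consts, List.length_append, AnnRule.size]
  omega

theorem foldl_bodyStep_mem {n : ℕ} {I : Interp V VP EP} {C : Set unitInterval}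
    (hI : ∀ A, I A ∈ C) (body : List (GAtom V VP EP × Annot σ n))
    (acc : (Fin n → unitInterval) × Bool) (hacc : ∀ x, acc.1 x ∈ C) (x : Fin n) :
    (body.foldl (bodyStep I) acc).1 x ∈ C := by
  induction body generalizing acc with
  | nil => exact hacc x
  | cons q body ih =>
    refine ih _ fun y => ?_
    obtain ⟨A, c | z | ⟨f, args⟩⟩ := q
    · exact hacc y
    · simp only [bodyStep]
      by_cases hy : y = z
      · subst hy
        rw [Function.update_self]
        rcases min_choice (acc.1 y) (I A) with h | h <;> rw [h]
        exacts [hacc y, hI A]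
      · rw [Function.update_of_ne hy]
        exact hacc y
    · exact hacc y

/-- Variables receive minima of values already in `C`. The element `1` is needed for variables that
annotate no body atom, and `0` for failed bodies. -/
theorem value_mem {r : GRule σ V VP EP} {I : Interp V VP EP} {C : Set unitInterval}
    (hr : r.ann.IsSimple) (h0 : 0 ∈ C) (h1 : 1 ∈ C) (hc : ∀ c ∈ r.consts, c ∈ C)
    (hI : ∀ A, I A ∈ C) : r.value I ∈ C := by
  unfold GRule.value
  split_ifs with h
  · have hv := foldl_bodyStep_mem hI r.body (fun _ => 1, true) fun _ => h1
    change ∀ x, (r.bodyValue I).1 x ∈ C at hv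
    generalize (r.bodyValue I).1 = θ at hv
    have hc' : ∀ c ∈ r.ann.consts, c ∈ C := fun c hc1 => hc c (List.mem_append_left _ hc1)
    generalize r.ann = μ at hr hc'
    cases μ with
    | const c => exact hc' c (by simp [Annot.consts])
    | var x => exact hv x
    | app f args => exact hr.elim
  · exact h0

theorem applyValue_mem {G : List (GRule σ V VP EP)} {I : Interp V VP EP} {C : Set unitInterval}
    (hG : ∀ r ∈ G, r.ann.IsSimple ∧ ∀ c ∈ r.consts, c ∈ C) (h0 : 0 ∈ C) (h1 : 1 ∈ C)
    (hI : ∀ A, I A ∈ C) (A : GAtom V VP EP) : applyValue G I A ∈ C := by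
  unfold applyValue
  have key : ∀ (l : List (GRule σ V VP EP)) (J : Interp V VP EP), (∀ r ∈ l, r.value I ∈ C) →
      (∀ A, J A ∈ C) → ∀ A, l.foldl
        (fun J r => Function.update J r.head (max (J r.head) (r.value I))) J A ∈ C := by
    intro l
    induction l with
    | nil => exact fun J _ hJ => hJ
    | cons r l ih =>
      intro J hl hJ
      refine ih _ (fun r hr => hl r (List.mem_cons_of_mem _ hr)) fun B => ?_
      dsimp only
      by_cases hB : B = r.head
      · subst hB
        rw [Function.update_self]
        rcases max_choice (J r.head) (r.value I) with h | h <;> rw [h]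
        exacts [hJ _, hl r List.mem_cons_self]
      · rw [Function.update_of_ne hB]
        exact hJ B
  exact key G _ (fun r hr => value_mem (hG r hr).1 h0 h1 (hG r hr).2 hI) (fun _ => h0) A

end Evaluation

/-- The iterates of a monotone operator from `0` become stationary within `|H||C| + 1` steps if
they have values in `C` and vanish outside `H`. -/
theorem iterate_stationary {ι : Type} {F : (ι → unitInterval) → ι → unitInterval}
    (hF : Monotone F) (H : Finset ι) (C : Finset unitInterval)
    (hH : ∀ n, ∀ A ∉ H, F^[n] (fun _ => 0) A = 0) (hC : ∀ n A, F^[n] (fun _ => 0) A ∈ C) :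
    F (F^[H.card * C.card + 1] (fun _ => 0)) = F^[H.card * C.card + 1] (fun _ => 0) := by
  set x : ℕ → ι → unitInterval := fun n => F^[n] (fun _ => 0) with hx
  have hsucc : ∀ n, x (n + 1) = F (x n) := fun n => Function.iterate_succ_apply' F n _
  have hmono : ∀ n, x n ≤ x (n + 1) := by
    intro n
    induction n with
    | zero => exact fun A => unitInterval.nonneg'
    | succ n ih =>
      rw [hsucc, hsucc (n + 1)]
      exact hF ih
  -- The rank counts, over the atoms of `H`, the elements of `C` below the current value. Every step
  -- that changes something raises it, and it never exceeds `|H||C|`.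
  have hrank : ∀ n, x (n + 1) = x n ∨
      n ≤ ∑ A ∈ H, (C.filter fun c => c ≤ x n A).card := by
    intro n
    induction n with
    | zero => exact Or.inr (Nat.zero_le _)
    | succ n ih =>
      by_cases heq : x (n + 1) = x n
      · left
        rw [hsucc (n + 1), heq, ← hsucc, heq]
      · right
        refine Nat.succ_le_of_lt (lt_of_le_of_lt (ih.resolve_left heq) ?_)
        obtain ⟨A, hA⟩ := Function.ne_iff.1 heq
        have hlt : x n A < x (n + 1) A := lt_of_le_of_ne (hmono n A) (Ne.symm hA)
        have hAH : A ∈ H := by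
          by_contra h
          exact hA ((hH (n + 1) A h).trans (hH n A h).symm)
        refine Finset.sum_lt_sum (fun B _ => Finset.card_le_card ?_)
          ⟨A, hAH, Finset.card_lt_card ?_⟩
        · intro c hc
          rw [Finset.mem_filter] at hc ⊢
          exact ⟨hc.1, hc.2.trans (hmono n B)⟩
        · refine Finset.ssubset_iff_of_subset ?_ |>.2 ⟨x (n + 1) A, ?_, ?_⟩
          · intro c hc
            rw [Finset.mem_filter] at hc ⊢
            exact ⟨hc.1, hc.2.trans (hmono n A)⟩
          · exact Finset.mem_filter.2 ⟨hC (n + 1) A, le_rfl⟩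
          · rw [Finset.mem_filter, not_and, not_le]
            exact fun _ => hlt
  refine ((hsucc _).symm.trans ?_ : F (x _) = x _)
  refine (hrank _).resolve_right (not_le.2 (Nat.lt_succ_of_le ?_))
  rw [← smul_eq_mul]
  exact Finset.sum_le_card_nsmul _ _ _ fun A _ => Finset.card_filter_le _ _

/-! ### Minimum models by iteration -/

theorem foldl_cons_eq {α β : Type} (f : α → β) (l : List α) (G : List β) :
    l.foldl (fun G a => f a :: G) G = (l.map f).reverse ++ G := by
  induction l generalizing G with
  | nil => rfl
  | cons a l ih => simp [ih]

theorem foldl_append_eq {α β : Type} (f : α → List β) (l : List α) (G : List β) :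
    l.foldl (fun G a => f a ++ G) G = l.reverse.flatMap f ++ G := by
  induction l generalizing G with
  | nil => rfl
  | cons a l ih => simp [ih]

theorem Rule.size_inst {σ : AnnSig} {V VP EP : Type} (r : Rule σ V VP EP)
    (s : Fin r.numVars → V) : (r.inst s).size = r.rule.size := by
  simp [Rule.inst, AnnRule.size, List.map_map, Function.comp_def]

theorem Rule.consts_inst {σ : AnnSig} {V VP EP : Type} (r : Rule σ V VP EP)
    (s : Fin r.numVars → V) : (r.inst s).consts = r.rule.consts := by
  simp [Rule.inst, AnnRule.consts, List.flatMap_map]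

theorem Rule.isTame_inst {σ : AnnSig} {V VP EP : Type} {r : Rule σ V VP EP}
    (hr : r.rule.IsTame) (s : Fin r.numVars → V) : (r.inst s).IsTame := by
  refine ⟨hr.1, fun q hq => ?_⟩
  obtain ⟨l, hl, rfl⟩ := List.mem_map.1 hq
  exact hr.2 l hl

namespace CGAP

variable {σ : AnnSig} {V VP EP : Type}

theorem isTame_choiceRule {m : ℕ} (P : CGAP σ V VP EP m) (v : V) (i : Fin m) :
    (P.choiceRule v i).IsTame := by
  refine ⟨Annot.IsSimple.eval_monotone (μ := (Annot.var (0 : Fin 1) : Annot σ 1)) trivial, ?_⟩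
  intro q hq
  obtain rfl : q = (Atom.vertex (P.a i) v, Annot.var (0 : Fin 1)) := List.mem_singleton.1 hq
  trivial

variable [Fintype V] (P : CGAP σ V VP EP 2)

/-- The list of ground rules that `ground` returns. -/
noncomputable def groundList (S : V → Fin 2) : List (GRule σ V VP EP) :=
  ((vertices V).map fun v => P.choiceRule v (S v)).reverse ++
    P.rules.reverse.flatMap fun r =>
      ((Finset.univ : Finset (Fin r.numVars → V)).toList.map r.inst).reverse

/-- A bound for the number of symbols of the ground rules. -/
noncomputable def groundCost : ℕ :=
  (P.rules.map fun r => Fintype.card V ^ r.numVars * r.size).sum + Fintype.card V * 5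

theorem mem_groundList {S : V → Fin 2} {g : GRule σ V VP EP} :
    g ∈ P.groundList S ↔ g ∈ P.induced S := by
  simp only [groundList, vertices, induced, groundRules, List.mem_append, List.mem_reverse,
    List.mem_map, Finset.mem_toList, Finset.mem_univ, true_and, List.mem_flatMap, Set.mem_union,
    Set.mem_ofPred_eq, eq_comm (a := g)]
  exact or_comm

theorem runsIn_ground (S : V → Fin 2) :
    RunsIn (P.ground S) (P.groundList S) P.groundCost := by
  have h : P.groundList S = (vertices V).foldl (fun G v => P.choiceRule v (S v) :: G)
      (P.rules.foldl (fun G r => (Finset.univ : Finset (Fin r.numVars → V)).toList.foldl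
        (fun G s => r.inst s :: G) G) []) := by
    simp only [foldl_cons_eq, foldl_append_eq, groundList, List.append_nil]
  rw [h]
  refine RunsIn.bind (RunsIn.foldlM (fun G r _ => ?_) _) ((RunsIn.foldlM (B := fun _ => 5)
    (fun G v _ => ?_) _).mono (by simp [vertices]))
  · refine (RunsIn.foldlM (B := fun _ => r.size) (fun G s _ => ?_) _).mono (by simp)
    exact RunsIn.tick_bind r.size (RunsIn.pure _)
  · exact RunsIn.tick_bind _ (RunsIn.pure _)

theorem sum_size_groundList_le (S : V → Fin 2) :
    ((P.groundList S).map AnnRule.size).sum ≤ P.groundCost := by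
  rw [groundList, List.map_append, List.sum_append, add_comm, groundCost]
  refine Nat.add_le_add ?_ (le_of_eq ?_)
  · rw [List.map_flatMap, List.flatMap, List.sum_flatten, List.map_map]
    rw [(P.rules.reverse_perm.map _).sum_eq]
    refine List.sum_le_sum fun r _ => ?_
    simp only [Function.comp_def, List.map_reverse, List.map_map, List.sum_reverse,
      Rule.size_inst, List.map_const', List.sum_replicate, Finset.length_toList, smul_eq_mul]
    simp only [Finset.card_univ, Fintype.card_fun, Fintype.card_fin]
    exact Nat.mul_le_mul_left _ (Nat.le_add_left _ _)
  -- The five symbols: one for the head, one annotation variable, the head annotation, and a body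
  -- atom with its annotation.
  · have h5 : ∀ v i, (P.choiceRule v i).size = 5 := fun v i => by
      simp [choiceRule, AnnRule.size, Annot.size]
    simp [Function.comp_def, h5, vertices]

/-- Every rule has at least one symbol; hence `groundCost` also bounds the guard's pass over the
heads and the number of distinct heads. -/
theorem length_groundList_le (S : V → Fin 2) : (P.groundList S).length ≤ P.groundCost := by
  refine le_trans ?_ (P.sum_size_groundList_le S)
  rw [← List.length_map (f := AnnRule.size)]
  refine List.length_le_sum_of_one_le _ fun n hn => ?_
  obtain ⟨r, -, rfl⟩ := List.mem_map.1 hn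
  unfold AnnRule.size
  omega

/-! ### Correctness and cost of the fixpoint iteration -/

variable {P}

theorem isTame_groundList (hP : ∀ r ∈ P.rules, r.rule.IsTame) {S : V → Fin 2}
    {g : GRule σ V VP EP} (hg : g ∈ P.groundList S) : g.IsTame := by
  rcases P.mem_groundList.1 hg with ⟨r, hr, s, rfl⟩ | ⟨v, rfl⟩
  · exact Rule.isTame_inst (hP r hr) s
  · exact P.isTame_choiceRule v _

theorem applyValue_groundList (hP : ∀ r ∈ P.rules, r.rule.IsTame) (S : V → Fin 2) :
    applyValue (P.groundList S) = tp (P.induced S) := by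
  funext I
  rw [applyValue_eq_tp fun g hg => isTame_groundList hP hg]
  congr 1
  ext g
  exact P.mem_groundList

/-- The fixpoint iteration is a procedure for minimum models. -/
theorem computesMM_iterMM (hP : ∀ r ∈ P.rules, r.rule.IsTame) {T : ℕ} (hT : P.ReachedWithin T) :
    P.ComputesMM P.iterMM (P.groundCost +
      ((T + 1) * (1 + (P.groundCost + P.groundCost)) + T * P.groundCost)) := by
  intro S
  have hF := applyValue_groundList hP S
  have hlen := P.length_groundList_le S
  have hrun : ∀ I, RunsIn (applyRules (P.groundList S) I) (applyValue (P.groundList S) I)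
      P.groundCost := fun I => (runsIn_applyRules _ I).mono (P.sum_size_groundList_le S)
  have hz : ∀ A, (∀ r ∈ P.groundList S, r.head ≠ A) → ∀ n,
      (applyValue (P.groundList S))^[n] (fun _ => 0) A = 0 :=
    fun A hA n => iterate_applyValue_eq_zero hA n
  have hground := P.runsIn_ground S
  have hTS := hT S
  rw [← hF] at hTS
  have hfix : applyValue (P.groundList S) (minModel (P.induced S)) = minModel (P.induced S) := by
    rw [hF, tp_minModel]
  have hstable : ∀ n, applyValue (P.groundList S) ((applyValue (P.groundList S))^[n] fun _ => 0) =
      ((applyValue (P.groundList S))^[n] fun _ => 0) →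
      ((applyValue (P.groundList S))^[n] fun _ => 0) = minModel (P.induced S) := by
    rw [hF]
    exact fun n => iterate_tp_eq_minModel
  unfold iterMM
  generalize P.groundList S = G at *
  have hguard : ∀ I, RunsIn (do
      let J ← applyRules G I
      G.foldlM (fun (changed : Bool) r => do
        Comp.tick 1
        pure (changed || decide (J r.head ≠ I r.head))) false : Comp Bool)
      (G.any fun r => decide (applyValue G I r.head ≠ I r.head))
      (P.groundCost + P.groundCost) := by
    intro I
    have h := foldl_or (fun r : GRule σ V VP EP => decide (applyValue G I r.head ≠ I r.head)) G false
    rw [Bool.false_or] at h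
    rw [← h]
    refine (hrun I).bind (RunsIn.mono (RunsIn.foldlM (B := fun _ => 1) (fun c r _ => ?_) false) ?_)
    · exact RunsIn.tick_bind 1 (RunsIn.pure (c || decide _))
    · simpa using hlen
  obtain ⟨I, k, ⟨j, -, rfl⟩, hI, h⟩ := RunsIn.whileLoop
    -- With `n` rounds left the current interpretation is the iterate of index `T - n`; at `n = 0`
    -- it is the minimum model, a fixed point, so the guard fails.
    (Q := fun n I => ∃ j, j + n = T ∧ I = (applyValue G)^[j] fun _ => 0) hguard hrun
    (by
      rintro I ⟨j, rfl, rfl⟩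
      rw [add_zero] at hTS
      simp [hTS, hfix])
    (by
      rintro n I ⟨j, hj, rfl⟩ -
      exact ⟨j + 1, by omega, (Function.iterate_succ_apply' _ _ _).symm⟩)
    T (fun _ => 0) ⟨0, by omega, rfl⟩
  -- The failed guard gives equality at the rule heads; at all other atoms both sides are `0`. The
  -- loop may stop before `T`, and a stationary iterate is already the minimum model.
  have hMM := hstable j (by
    funext A
    by_cases hA : ∀ r ∈ G, r.head ≠ A
    · exact (applyValue_eq_zero hA).trans (hz A hA j).symm
    · push Not at hA
      obtain ⟨r, hr, rfl⟩ := hA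
      simpa using List.any_eq_false.1 hI r hr)
  rw [hMM] at h
  exact hground.bind h

/-- A number of iterations that suffices if all annotations are variables or constants. -/
theorem IsElementary.reachedWithin (hP : P.IsElementary) :
    P.ReachedWithin (P.groundCost * (P.size + 2) + 1) := by
  intro S
  have htame : ∀ r ∈ P.rules, r.rule.IsTame := fun r hr =>
    ⟨(hP r hr).1.eval_monotone, (hP r hr).2⟩
  have hF := applyValue_groundList htame S
  let H : Finset (GAtom V VP EP) := ((P.groundList S).map AnnRule.head).toFinset
  let L : List unitInterval := 0 :: 1 :: P.rules.flatMap fun r => r.rule.consts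
  have hH : H.card ≤ P.groundCost := by
    refine (List.toFinset_card_le _).trans ?_
    rw [List.length_map]
    exact P.length_groundList_le S
  have hL : L.toFinset.card ≤ P.size + 2 := by
    refine (List.toFinset_card_le _).trans ?_
    simp only [L, List.length_cons, List.length_flatMap, size]
    have : (P.rules.map fun r => r.rule.consts.length).sum ≤ (P.rules.map Rule.size).sum :=
      List.sum_le_sum fun r _ => r.rule.length_consts_le.trans (Nat.le_add_left _ _)
    omega
  have hG : ∀ g ∈ P.groundList S, g.ann.IsSimple ∧ ∀ c ∈ g.consts, c ∈ {c | c ∈ L} := by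
    intro g hg
    rcases P.mem_groundList.1 hg with ⟨r, hr, s, rfl⟩ | ⟨v, rfl⟩
    · refine ⟨(hP r hr).1, fun c hc => ?_⟩
      rw [Rule.consts_inst] at hc
      exact List.mem_cons_of_mem _ (List.mem_cons_of_mem _ (List.mem_flatMap.2 ⟨r, hr, hc⟩))
    · exact ⟨trivial, by simp [choiceRule, AnnRule.consts, Annot.consts]⟩
  have hval : ∀ n A, (tp (P.induced S))^[n] (fun _ => 0) A ∈ {c | c ∈ L} := by
    intro n
    induction n with
    | zero => exact fun A => List.mem_cons_self
    | succ n ih =>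
      rw [Function.iterate_succ_apply', ← hF] at *
      exact applyValue_mem hG List.mem_cons_self (List.mem_cons_of_mem _ List.mem_cons_self) ih
  have hzero : ∀ n, ∀ A ∉ H, (tp (P.induced S))^[n] (fun _ => 0) A = 0 := by
    intro n A hA
    rw [← hF]
    refine iterate_applyValue_eq_zero (fun r hr hrA => hA ?_) n
    exact List.mem_toFinset.2 (List.mem_map.2 ⟨r, hr, hrA⟩)
  have hst := iterate_tp_eq_minModel (iterate_stationary (tp_monotone _) H L.toFinset hzero
    fun n A => List.mem_toFinset.2 (hval n A))
  have hle : H.card * L.toFinset.card + 1 ≤ P.groundCost * (P.size + 2) + 1 :=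
    Nat.succ_le_succ (Nat.mul_le_mul hH hL)
  -- The stationary index depends on `S`; further iterations up to the uniform bound change nothing.
  obtain ⟨d, hd⟩ := Nat.exists_eq_add_of_le' hle
  rw [hd, Function.iterate_add_apply, hst]
  exact Function.iterate_fixed (tp_minModel _) d

variable (P) in
theorem groundCost_le {k : ℕ} (hk : ∀ r ∈ P.rules, r.numVars ≤ k) :
    P.groundCost ≤ (P.size + 1) ^ k * P.size + P.size * 5 := by
  have hV : Fintype.card V ≤ P.size := Nat.le_add_right _ _
  refine Nat.add_le_add ?_ (Nat.mul_le_mul_right _ hV)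
  calc (P.rules.map fun r => Fintype.card V ^ r.numVars * r.size).sum
      ≤ (P.rules.map fun r => (P.size + 1) ^ k * r.size).sum := by
        refine List.sum_le_sum fun r hr => Nat.mul_le_mul_right _ ?_
        -- The base `P.size + 1` is positive, which allows the exponent to be raised to `k` even
        -- when there are no vertices.
        exact (Nat.pow_le_pow_left (hV.trans (Nat.le_succ _)) _).trans
          (Nat.pow_le_pow_right (Nat.succ_pos _) (hk r hr))
    _ = (P.size + 1) ^ k * (P.rules.map Rule.size).sum := by rw [List.sum_map_mul_left]
    _ ≤ _ := Nat.mul_le_mul_left _ (Nat.le_add_left _ _)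

end CGAP

/-! ### Polynomial bounds -/

open Polynomial

theorem eval_mono (p : ℕ[X]) : Monotone fun n => p.eval n := by
  intro x y h
  simp only [Polynomial.eval_eq_sum, Polynomial.sum]
  exact Finset.sum_le_sum fun i _ => Nat.mul_le_mul_left _ (Nat.pow_le_pow_left h i)

/-- The bound for `findSE` in terms of the cost of one minimum model. -/
noncomputable def boundSE : ℕ[X] := 7 * (X + 1) ^ 2

/-- The bound for the size of the grounding of programs with at most `k` variables per rule. -/
noncomputable def boundGround (k : ℕ) : ℕ[X] := (X + 1) ^ k * X + X * 5

/-- The bound for `findSE` with minimum models computed by iteration. -/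
noncomputable def boundIter (k : ℕ) : ℕ[X] :=
  boundSE.comp (X + (boundGround k +
    ((X + 1) * (1 + (boundGround k + boundGround k)) + X * boundGround k)))

/-- The bound for programs without annotation functions. -/
noncomputable def boundElementary (k : ℕ) : ℕ[X] :=
  (boundIter k).comp (X + (boundGround k * (X + 2) + 1))

namespace CGAP

variable {σ : AnnSig} {V VP EP : Type} [Fintype V] {P : CGAP σ V VP EP 2}

theorem groundCost_le_boundGround {k : ℕ} (hk : ∀ r ∈ P.rules, r.numVars ≤ k) :
    P.groundCost ≤ (boundGround k).eval P.size := by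
  simpa [boundGround] using P.groundCost_le hk

theorem exists_findSE_iterMM_returns (hP : P.IsVIC) (htame : ∀ r ∈ P.rules, r.rule.IsTame)
    {k : ℕ} (hk : ∀ r ∈ P.rules, r.numVars ≤ k) {T : ℕ} (hT : P.ReachedWithin T) :
    ∃ (S : V → Fin 2) (t : ℕ),
      Comp.Returns (P.findSE P.iterMM) (minModel (P.induced S)) t ∧ P.Represents S ∧
      P.IsStrongEquilibrium (minModel (P.induced S)) ∧ t ≤ (boundIter k).eval (P.size + T) := by
  obtain ⟨S, t, h1, h2, h3, h4⟩ := exists_findSE_returns hP (computesMM_iterMM htame hT)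
  refine ⟨S, t, h1, h2, h3, h4.trans ?_⟩
  have hV : Fintype.card V ≤ P.size := Nat.le_add_right _ _
  have hg : P.groundCost ≤ (boundGround k).eval (P.size + T) :=
    (groundCost_le_boundGround hk).trans (eval_mono _ (Nat.le_add_right _ _))
  have hV' : Fintype.card V ≤ P.size + T := hV.trans (Nat.le_add_right _ _)
  have hT' : T ≤ P.size + T := Nat.le_add_left _ _
  -- After evaluation both sides are the same expression, in `|V|`, `T` and `groundCost` on the left
  -- and in their bounds at `P.size + T` on the right.
  simp only [boundIter, boundSE, eval_comp, eval_add, eval_mul, eval_pow, eval_X, eval_one,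
    eval_ofNat]
  gcongr

end CGAP

end ChoiceGAP

theorem mainTheorem7 :
    -- every VIC_2 program has a strong equilibrium
    (∀ (σ : ChoiceGAP.AnnSig) (V VP EP : Type) [Fintype V] (P : ChoiceGAP.CGAP σ V VP EP 2),
      P.IsVIC → ∃ I, P.IsStrongEquilibrium I) ∧
    -- findSE returns one, in time polynomial in the number of players and the time M that is
    -- needed for one minimum model
    (∃ p : Polynomial ℕ,
      ∀ (σ : ChoiceGAP.AnnSig) (V VP EP : Type) [Fintype V] (P : ChoiceGAP.CGAP σ V VP EP 2),
      P.IsVIC →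
      ∀ (mm : (V → Fin 2) → ChoiceGAP.Comp (ChoiceGAP.Interp V VP EP)) (M : ℕ),
      P.ComputesMM mm M →
      ∃ (S : V → Fin 2) (t : ℕ),
        ChoiceGAP.Comp.Returns (P.findSE mm) (ChoiceGAP.minModel (P.induced S)) t ∧
        P.Represents S ∧
        P.IsStrongEquilibrium (ChoiceGAP.minModel (P.induced S)) ∧
        t ≤ p.eval (Fintype.card V + M)) ∧
    -- with minimum models computed by fixpoint iteration, findSE returns one in time polynomial in
    -- the size of the program and the number of iterations
    (∀ k : ℕ, ∃ p : Polynomial ℕ,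
      ∀ (σ : ChoiceGAP.AnnSig) (V VP EP : Type) [Fintype V] (P : ChoiceGAP.CGAP σ V VP EP 2),
      P.IsVIC → P.IsSimple → (∀ r ∈ P.rules, r.numVars ≤ k) →
      ∀ T : ℕ, P.ReachedWithin T →
      ∃ (S : V → Fin 2) (t : ℕ),
        ChoiceGAP.Comp.Returns (P.findSE P.iterMM) (ChoiceGAP.minModel (P.induced S)) t ∧
        P.Represents S ∧
        P.IsStrongEquilibrium (ChoiceGAP.minModel (P.induced S)) ∧
        t ≤ p.eval (P.size + T)) ∧
    -- the number of iterations need not be mentioned if no annotation functions are used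
    (∀ k : ℕ, ∃ p : Polynomial ℕ,
      ∀ (σ : ChoiceGAP.AnnSig) (V VP EP : Type) [Fintype V] (P : ChoiceGAP.CGAP σ V VP EP 2),
      P.IsVIC → P.IsElementary → (∀ r ∈ P.rules, r.numVars ≤ k) →
      ∃ (S : V → Fin 2) (t : ℕ),
        ChoiceGAP.Comp.Returns (P.findSE P.iterMM) (ChoiceGAP.minModel (P.induced S)) t ∧
        P.Represents S ∧
        P.IsStrongEquilibrium (ChoiceGAP.minModel (P.induced S)) ∧
        t ≤ p.eval P.size) := by
  refine ⟨fun σ V VP EP _ P hP => ChoiceGAP.CGAP.exists_isStrongEquilibrium hP,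
    ⟨ChoiceGAP.boundSE, fun σ V VP EP _ P hP mm M hmm => ?_⟩,
    fun k => ⟨ChoiceGAP.boundIter k, fun σ V VP EP _ P hP hs hk T hT => ?_⟩,
    fun k => ⟨ChoiceGAP.boundElementary k, fun σ V VP EP _ P hP he hk => ?_⟩⟩
  · obtain ⟨S, t, h1, h2, h3, h4⟩ := ChoiceGAP.CGAP.exists_findSE_returns hP hmm
    exact ⟨S, t, h1, h2, h3, by simpa [ChoiceGAP.boundSE] using h4⟩
  · exact ChoiceGAP.CGAP.exists_findSE_iterMM_returns hP
      (fun r hr => ⟨ChoiceGAP.Annot.eval_monotone hs.1 _, hs.2 r hr⟩) hk hT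
  · obtain ⟨S, t, h1, h2, h3, h4⟩ := ChoiceGAP.CGAP.exists_findSE_iterMM_returns hP
      (fun r hr => ⟨(he r hr).1.eval_monotone, (he r hr).2⟩) hk he.reachedWithin
    refine ⟨S, t, h1, h2, h3, h4.trans ?_⟩
    have hg := ChoiceGAP.CGAP.groundCost_le_boundGround hk
    simp only [ChoiceGAP.boundElementary, Polynomial.eval_comp, Polynomial.eval_add,
      Polynomial.eval_mul, Polynomial.eval_X, Polynomial.eval_one, Polynomial.eval_ofNat]
    -- It remains to bound the number of iterations from `reachedWithin` by a polynomial in the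
    -- size.
    refine ChoiceGAP.eval_mono _ ?_
    gcongr
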